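/- Words are finite sequences of letters. A factor of a word $w$ is a contiguous subword (possibly empty); an occurrence of $v$ in $w$ is a position of $w$ at which $v$ starts as a factor (the empty word occurs $|w|+1$ times). A word $u$ is a left special (resp. right special) factor of $w$ if there are distinct letters $a\ne b$ such that $au$ and $bu$ (resp. $ua$ and $ub$) are factors of $w$; it is bispecial if it is both. Let $f_w(n)$ be the number of distinct factors of $w$ of length $n$, let $R_w$ be the least $n\ge 0$ such that $w$ has no right special factor of length $n$, let $K_w$ be the least length of a suffix of $w$ that occurs only once in $w$, and put $m_w=\min\{R_w,K_w\}$, $M_w=\max\{R_w,K_w\}$. A non-empty word $w$ is trapezoidal if $f_w(i)=i+1$ for $0\le i\le m_w$, $f_w(i+1)=f_w(i)$ for $m_w\le i\le M_w-1$, and $f_w(i+1)=f_w(i)-1$ for $M_w\le i\le |w|$. A word $w$ is closed if it is empty or has a factor $v\neq w$ that occurs exactly twice in $w$, once as a prefix and once as a suffix. A positive integer $p$ is a period of a word $u=u_1\cdots u_n$ if $u_i=u_{i+p}$ whenever $1\le i$ and $i+p\le n$ (so every $p\ge n$ is a period). A word $u$ is central if it has two coprime periods $p,q$ with $|u|=p+q-2$.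 **Lemma.** Let $w$ be a closed trapezoidal word, and let $u$ be a left special factor of $w$ of maximal length. Then $u$ is also the (unique) longest right special factor of $w$; in particular $u$ is a bispecial factor of $w$. Moreover, $u$ is a central word. -/

import Mathlib

namespace TrapWord

/-- The set of occurrences (starting positions) of `v` in the word `w`. The bound `i ≤ w.length`
makes the empty word occur exactly `w.length + 1` times. -/
def occurrences {α : Type*} (w v : List α) : Set ℕ :=
  {i | i ≤ w.length ∧ v <+: w.drop i}

/-- The factor complexity: the number of distinct factors of `w` of length `n`. -/
noncomputable def complexity {α : Type*} (w : List α) (n : ℕ) : ℕ :=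
  Set.ncard {v : List α | v <:+: w ∧ v.length = n}

/-- `u` is a left special factor of `w`. -/
def IsLeftSpecial {α : Type*} (w u : List α) : Prop :=
  ∃ a b : α, a ≠ b ∧ (a :: u) <:+: w ∧ (b :: u) <:+: w

/-- `u` is a right special factor of `w`. -/
def IsRightSpecial {α : Type*} (w u : List α) : Prop :=
  ∃ a b : α, a ≠ b ∧ (u ++ [a]) <:+: w ∧ (u ++ [b]) <:+: w

/-- `u` is a bispecial factor of `w`. -/
def IsBispecial {α : Type*} (w u : List α) : Prop :=
  IsLeftSpecial w u ∧ IsRightSpecial w u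

/-- `u` is a left special factor of `w` of maximal length. -/
def IsLongestLeftSpecial {α : Type*} (w u : List α) : Prop :=
  IsLeftSpecial w u ∧ ∀ v : List α, IsLeftSpecial w v → v.length ≤ u.length

/-- `u` is a right special factor of `w` of maximal length. -/
def IsLongestRightSpecial {α : Type*} (w u : List α) : Prop :=
  IsRightSpecial w u ∧ ∀ v : List α, IsRightSpecial w v → v.length ≤ u.length

/-- `K_w`: the minimal length of a suffix of `w` that occurs only once in `w`. -/
noncomputable def paramK {α : Type*} (w : List α) : ℕ :=
  sInf {n | ∃ v : List α, v <:+ w ∧ v.length = n ∧ (occurrences w v).ncard = 1}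

/-- `R_w`: the minimal length for which `w` has no right special factor of that length. -/
noncomputable def paramR {α : Type*} (w : List α) : ℕ :=
  sInf {n | ∀ v : List α, v.length = n → ¬ IsRightSpecial w v}

/-- A nonempty word is trapezoidal if, with `m = min R_w K_w` and `M = max R_w K_w`, its
complexity is `i + 1` on `[0, m]`, constant on `[m, M]`, and drops by one at each step from `M`
up to `|w| + 1`. -/
def IsTrapezoidal {α : Type*} (w : List α) : Prop :=
  w ≠ [] ∧
  (∀ i : ℕ, i ≤ min (paramR w) (paramK w) → complexity w i = i + 1) ∧
  (∀ i : ℕ, min (paramR w) (paramK w) ≤ i → i < max (paramR w) (paramK w) →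
    complexity w (i + 1) = complexity w i) ∧
  (∀ i : ℕ, max (paramR w) (paramK w) ≤ i → i ≤ w.length →
    complexity w (i + 1) + 1 = complexity w i)

/-- A word is closed if it is empty or has a factor, different from the word itself, that occurs
exactly twice in it, as a prefix and as a suffix. -/
def IsClosedWord {α : Type*} (w : List α) : Prop :=
  w = [] ∨ ∃ v : List α, v ≠ w ∧ v <+: w ∧ v <:+ w ∧ (occurrences w v).ncard = 2

/-- A word is central if it has two coprime (positive) periods `p` and `q` and length `p + q - 2`.
Here, as usual for central words, every `p ≥ |w|` counts as a period of `w`, so that the empty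
word and the powers of a letter are central. -/
def IsCentral {α : Type*} (w : List α) : Prop :=
  ∃ p q : ℕ, 0 < p ∧ 0 < q ∧ Nat.Coprime p q ∧ w.HasPeriod p ∧ w.HasPeriod q ∧
    w.length + 2 = p + q

end TrapWord

namespace TrapWord

/-! Let v be the closing border. The suffix of length |v| + 1 is the shortest unrepeated one, so K =
|v| + 1, and the trapezoidal shape forces |w| = R + K. Comparing f(n) with f(n + 1) through deletion
of the last letter, w has exactly one right special factor of each length n < R; applied to the
reversed word, this gives the same for left special factors, and none of length R. So both longest
special factors have length R - 1. If either is bispecial, uniqueness identifies them; otherwise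
each of them equals v. The border gives w the period |w| - |v| = R + 1 = |u| + 2. Two occurrences of
u with different right extensions, reduced modulo this period, yield periods p and q of u with p + q
= |u| + 2; Fine and Wilf's theorem forces them to be coprime. -/

/-- `v` is a proper border of `w` whose only occurrences in `w` are as a prefix and as a suffix. -/
structure IsClosingBorder {α : Type*} (w v : List α) : Prop where
  isPrefix : v <+: w
  isSuffix : v <:+ w
  ne : v ≠ w
  eq_nil_or_eq_nil : ∀ s t : List α, w = s ++ v ++ t → s = [] ∨ t = []

variable {α : Type*} {w u v : List α}

theorem finite_factors (w : List α) (n : ℕ) : {x : List α | x <:+: w ∧ x.length = n}.Finite := by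
  refine (List.finite_toSet w.sublists).subset ?_
  rintro x ⟨hx, -⟩
  exact List.mem_sublists.2 hx.sublist

theorem mem_occurrences_of_eq {s t : List α} (h : w = s ++ v ++ t) :
    s.length ∈ occurrences w v := by
  subst h
  exact ⟨by simp, by simp⟩

theorem exists_eq_of_mem_occurrences {i : ℕ} (h : i ∈ occurrences w v) :
    ∃ s t : List α, w = s ++ v ++ t ∧ s.length = i := by
  obtain ⟨hi, t, ht⟩ := h
  refine ⟨w.take i, t, ?_, by simpa using hi⟩
  rw [List.append_assoc, ht, List.take_append_drop]

theorem finite_occurrences (w v : List α) : (occurrences w v).Finite :=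
  (Set.finite_Iic w.length).subset fun _ h => h.1

theorem zero_mem_occurrences (h : v <+: w) : 0 ∈ occurrences w v := ⟨by simp, by simpa using h⟩

theorem length_sub_mem_occurrences (h : v <:+ w) : w.length - v.length ∈ occurrences w v := by
  obtain ⟨s, rfl⟩ := h
  exact ⟨by simp, by simp⟩

theorem IsClosedWord.exists_isClosingBorder (h : IsClosedWord w) (hw : w ≠ []) :
    ∃ v, IsClosingBorder w v := by
  obtain rfl | ⟨v, hne, hp, hs, hc⟩ := h
  · exact absurd rfl hw
  have hlt : v.length < w.length :=
    lt_of_le_of_ne hp.length_le fun e => hne (hp.eq_of_length e)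
  refine ⟨v, hp, hs, hne, fun s t hst => ?_⟩
  have hpair : ({0, w.length - v.length} : Set ℕ) = occurrences w v := by
    refine Set.eq_of_subset_of_ncard_le ?_ ?_ (finite_occurrences w v)
    · rintro i (rfl | rfl)
      · exact zero_mem_occurrences hp
      · exact length_sub_mem_occurrences hs
    · rw [hc, Set.ncard_pair (by omega)]
  have hmem : s.length ∈ ({0, w.length - v.length} : Set ℕ) := hpair ▸ mem_occurrences_of_eq hst
  have hl := congrArg List.length hst
  simp only [List.length_append] at hl
  rcases hmem with h0 | h0
  · exact Or.inl (List.length_eq_zero_iff.1 h0)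
  · exact Or.inr (List.length_eq_zero_iff.1 (by simp only [Set.mem_singleton_iff] at h0; omega))

/-! ### Extendability of factors and counting of special factors -/

namespace IsClosingBorder

theorem length_lt (h : IsClosingBorder w v) : v.length < w.length :=
  lt_of_le_of_ne h.isPrefix.length_le fun e => h.ne (h.isPrefix.eq_of_length e)

theorem reverse (h : IsClosingBorder w v) : IsClosingBorder w.reverse v.reverse where
  isPrefix := List.reverse_prefix.2 h.isSuffix
  isSuffix := List.reverse_suffix.2 h.isPrefix
  ne e := h.ne (List.reverse_injective e)
  eq_nil_or_eq_nil s t e := by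
    have e' : w = t.reverse ++ v ++ s.reverse := by
      rw [← List.reverse_reverse w, e]; simp
    simpa using (h.eq_nil_or_eq_nil _ _ e').symm

/-- A factor not longer than the closing border can be extended to the right. -/
theorem exists_concat_infix (h : IsClosingBorder w v) {x : List α} (hx : x <:+: w)
    (hlen : x.length ≤ v.length) : ∃ a, x ++ [a] <:+: w := by
  obtain ⟨s, t, rfl⟩ := hx
  rcases t with _ | ⟨a, t⟩
  · have hxv : x <:+ v := List.suffix_of_suffix_length_le ⟨s, by simp⟩ h.isSuffix hlen
    obtain ⟨y, rfl⟩ := hxv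
    obtain ⟨t, ht⟩ := h.isPrefix
    rcases t with _ | ⟨a, t⟩
    · exact absurd (by simpa using ht) h.ne
    · exact ⟨a, y, t, by rw [← ht]; simp⟩
  · exact ⟨a, s, t, by simp⟩

/-- A suffix longer than the closing border cannot be extended to the right. -/
theorem not_concat_infix (h : IsClosingBorder w v) {x : List α} (hx : x <:+ w)
    (hlen : v.length < x.length) (a : α) : ¬ x ++ [a] <:+: w := by
  rintro ⟨s, t, hst⟩
  obtain ⟨y, rfl⟩ := List.suffix_of_suffix_length_le h.isSuffix hx hlen.le
  rcases h.eq_nil_or_eq_nil (s ++ y) (a :: t) (by rw [← hst]; simp) with e | e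
  · simp only [List.append_eq_nil_iff] at e
    simp [e.2] at hlen
  · simp at e

theorem paramK_eq (h : IsClosingBorder w v) : paramK w = v.length + 1 := by
  have hlt := h.length_lt
  have hmem : v.length + 1 ∈
      {n | ∃ x : List α, x <:+ w ∧ x.length = n ∧ (occurrences w x).ncard = 1} := by
    have hx : w.drop (w.length - (v.length + 1)) <:+ w := List.drop_suffix _ _
    have hl : (w.drop (w.length - (v.length + 1))).length = v.length + 1 := by
      rw [List.length_drop]; omega
    refine ⟨_, hx, hl, Set.ncard_eq_one.2 ⟨_, Set.eq_singleton_iff_unique_mem.2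
      ⟨length_sub_mem_occurrences hx, fun i hi => ?_⟩⟩⟩
    obtain ⟨s, t, hst, rfl⟩ := exists_eq_of_mem_occurrences hi
    rcases t with _ | ⟨a, t⟩
    · have := congrArg List.length hst
      simp only [List.length_append, List.length_nil] at this
      omega
    · exact absurd ⟨s, t, by simpa using hst.symm⟩ (h.not_concat_infix hx (by omega) a)
  refine le_antisymm (Nat.sInf_le hmem) (le_csInf ⟨_, hmem⟩ ?_)
  rintro n ⟨x, hx, rfl, hc⟩
  by_contra! hlt'
  have hxv : x <:+ v := List.suffix_of_suffix_length_le hx h.isSuffix (by omega)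
  obtain ⟨y, rfl⟩ := hxv
  obtain ⟨t, ht⟩ := h.isPrefix
  -- A suffix of length at most |v| also ends the prefix copy of `v`, hence occurs twice.
  have h1 : y.length ∈ occurrences w x := mem_occurrences_of_eq ht.symm
  have h2 := length_sub_mem_occurrences hx
  obtain ⟨z, hz⟩ := Set.ncard_eq_one.1 hc
  rw [hz, Set.mem_singleton_iff] at h1 h2
  simp only [List.length_append] at hlt
  omega

/-- The factors of length `n` that extend to the right are obtained by deleting the last letter
of the factors of length `n + 1`; only the suffix of length `n > |v|` does not arise so. -/
theorem ncard_dropLast_image (h : IsClosingBorder w v) {n : ℕ} (hn : n ≤ w.length) :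
    (List.dropLast '' {x | x <:+: w ∧ x.length = n + 1}).ncard +
      (if v.length < n then 1 else 0) = complexity w n := by
  have himg : List.dropLast '' {x | x <:+: w ∧ x.length = n + 1} =
      {x | (x <:+: w ∧ x.length = n) ∧ ∃ a, x ++ [a] <:+: w} := by
    ext x
    constructor
    · rintro ⟨y, ⟨hy, hl⟩, rfl⟩
      have hne : y ≠ [] := by rintro rfl; simp at hl
      refine ⟨⟨(List.dropLast_prefix y).isInfix.trans hy, by simp [hl]⟩, y.getLast hne, ?_⟩
      rwa [List.dropLast_append_getLast]
    · rintro ⟨⟨-, hl⟩, a, ha⟩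
      exact ⟨x ++ [a], ⟨ha, by simp [hl]⟩, by simp⟩
  rw [himg, complexity]
  split_ifs with hv
  · have hs : w.drop (w.length - n) <:+ w := List.drop_suffix _ _
    have hsl : (w.drop (w.length - n)).length = n := by rw [List.length_drop]; omega
    have : {x | (x <:+: w ∧ x.length = n) ∧ ∃ a, x ++ [a] <:+: w} =
        {x | x <:+: w ∧ x.length = n} \ {w.drop (w.length - n)} := by
      ext x
      constructor
      · rintro ⟨hx, a, ha⟩
        refine ⟨hx, fun e => ?_⟩
        rw [Set.mem_singleton_iff] at e
        subst e
        exact h.not_concat_infix hs (by omega) a ha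
      · rintro ⟨hx, hne⟩
        refine ⟨hx, ?_⟩
        obtain ⟨⟨s, t, hst⟩, hl⟩ := hx
        rcases t with _ | ⟨a, t⟩
        · refine absurd ?_ hne
          have hx : x <:+ w := ⟨s, by simpa using hst⟩
          exact (List.suffix_of_suffix_length_le hx hs (by omega)).eq_of_length (by omega)
        · exact ⟨a, s, t, by rw [← hst]; simp⟩
    rw [this]
    exact Set.ncard_sdiff_singleton_add_one ⟨hs.isInfix, hsl⟩ (finite_factors w n)
  · have : {x | (x <:+: w ∧ x.length = n) ∧ ∃ a, x ++ [a] <:+: w} =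
        {x | x <:+: w ∧ x.length = n} := by
      ext x
      exact ⟨fun hx => hx.1, fun hx => ⟨hx, h.exists_concat_infix hx.1 (by rw [hx.2]; omega)⟩⟩
    rw [this, add_zero]

/-- The count makes `List.dropLast` injective on factors of length n + 1, while a right special
factor gives two preimages. -/
theorem not_isRightSpecial (h : IsClosingBorder w v) {n : ℕ} (hn : n ≤ w.length)
    (hc : complexity w (n + 1) + (if v.length < n then 1 else 0) = complexity w n)
    {x : List α} (hx : x.length = n) : ¬ IsRightSpecial w x := by
  rintro ⟨a, b, hab, ha, hb⟩
  have hinj : Set.InjOn List.dropLast {x | x <:+: w ∧ x.length = n + 1} := by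
    refine Set.injOn_of_ncard_image_eq ?_ (finite_factors w (n + 1))
    have := h.ncard_dropLast_image hn
    rw [complexity] at hc
    omega
  have := hinj (x₁ := x ++ [a]) (x₂ := x ++ [b]) ⟨ha, by simp [hx]⟩ ⟨hb, by simp [hx]⟩ (by simp)
  exact hab (by simpa using this)

theorem existsUnique_isRightSpecial (h : IsClosingBorder w v) {n : ℕ} (hn : n ≤ w.length)
    (hc : complexity w (n + 1) + (if v.length < n then 1 else 0) = complexity w n + 1) :
    ∃! x : List α, IsRightSpecial w x ∧ x.length = n := by
  have himg := h.ncard_dropLast_image hn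
  have hfin := finite_factors w (n + 1)
  have hcard : {x | x <:+: w ∧ x.length = n + 1}.ncard =
      (List.dropLast '' {x | x <:+: w ∧ x.length = n + 1}).ncard + 1 := by
    rw [complexity] at hc
    omega
  have hex : ∃ x : List α, IsRightSpecial w x ∧ x.length = n := by
    have hninj : ¬ Set.InjOn List.dropLast {x | x <:+: w ∧ x.length = n + 1} := fun hi => by
      rw [hi.ncard_image] at hcard
      omega
    simp only [Set.InjOn, not_forall] at hninj
    obtain ⟨x, ⟨hx, hxl⟩, y, ⟨hy, hyl⟩, hxy, hne⟩ := hninj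
    have hx0 : x ≠ [] := by rintro rfl; simp at hxl
    have hy0 : y ≠ [] := by rintro rfl; simp at hyl
    have ex := List.dropLast_append_getLast hx0
    have ey := List.dropLast_append_getLast hy0
    refine ⟨x.dropLast, ⟨x.getLast hx0, y.getLast hy0, fun e => hne ?_, ?_, ?_⟩, by simp [hxl]⟩
    · rw [← ex, ← ey, hxy, e]
    · rwa [ex]
    · rwa [hxy, ey]
  obtain ⟨x, hx, hxl⟩ := hex
  refine ⟨x, ⟨hx, hxl⟩, ?_⟩
  rintro y ⟨hy, hyl⟩
  by_contra hne
  obtain ⟨a, b, hab, ha, hb⟩ := hx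
  obtain ⟨c, d, hcd, hc', hd⟩ := hy
  set S := {x | x <:+: w ∧ x.length = n + 1} with hS
  have hxa : x ++ [a] ∈ S := ⟨ha, by simp [hxl]⟩
  have hxb : x ++ [b] ∈ S := ⟨hb, by simp [hxl]⟩
  have hyc : y ++ [c] ∈ S := ⟨hc', by simp [hyl]⟩
  have hyd : y ++ [d] ∈ S := ⟨hd, by simp [hyl]⟩
  have hne' : x ++ [a] ≠ y ++ [c] := fun e => hne (by simpa using (congrArg List.dropLast e).symm)
  -- With two right special factors, removing one extension of each keeps the image intact, so the
  -- image would be smaller than `S` by at least two.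
  have hsub : List.dropLast '' S ⊆ List.dropLast '' (S \ {x ++ [a], y ++ [c]}) := by
    rintro _ ⟨z, hz, rfl⟩
    by_cases hza : z = x ++ [a]
    · refine ⟨x ++ [b], ⟨hxb, ?_⟩, by simp [hza]⟩
      rintro (e | e)
      · exact hab (by simpa using e.symm)
      · exact hne (by simpa using (congrArg List.dropLast e).symm)
    by_cases hzc : z = y ++ [c]
    · refine ⟨y ++ [d], ⟨hyd, ?_⟩, by simp [hzc]⟩
      rintro (e | e)
      · exact hne (by simpa using congrArg List.dropLast e)
      · exact hcd (by simpa using e.symm)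
    · exact ⟨z, ⟨hz, by simp [hza, hzc]⟩, rfl⟩
  have h1 := Set.ncard_le_ncard hsub ((hfin.sdiff).image _)
  have h2 := Set.ncard_image_le (f := List.dropLast) (hfin.sdiff (t := {x ++ [a], y ++ [c]}))
  have h3 := Set.ncard_sdiff_add_ncard_of_subset (s := {x ++ [a], y ++ [c]}) (t := S)
    (by rintro z (rfl | rfl) <;> assumption) hfin
  rw [Set.ncard_pair hne'] at h3
  omega

end IsClosingBorder

/-! ### Reversal and hereditary properties -/

theorem isRightSpecial_reverse_iff {x : List α} :
    IsRightSpecial w.reverse x.reverse ↔ IsLeftSpecial w x := by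
  simp only [IsRightSpecial, IsLeftSpecial, ← List.reverse_cons, List.reverse_infix]

theorem complexity_reverse (w : List α) (n : ℕ) : complexity w.reverse n = complexity w n := by
  unfold complexity
  rw [← Set.ncard_image_of_injective _ List.reverse_injective]
  congr 1
  ext x
  simp only [Set.mem_image, Set.mem_ofPred_eq]
  constructor
  · rintro ⟨y, ⟨hy, hl⟩, rfl⟩
    exact ⟨by rw [← List.reverse_infix]; simpa using hy, by simpa using hl⟩
  · rintro ⟨hx, hl⟩
    exact ⟨x.reverse, ⟨List.reverse_infix.2 hx, by simpa using hl⟩, by simp⟩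

theorem IsRightSpecial.length_lt (h : IsRightSpecial w u) : u.length < w.length := by
  obtain ⟨a, -, -, ha, -⟩ := h
  simpa using ha.length_le

theorem IsRightSpecial.of_suffix (h : IsRightSpecial w u) (hv : v <:+ u) :
    IsRightSpecial w v := by
  obtain ⟨a, b, hab, ha, hb⟩ := h
  obtain ⟨s, rfl⟩ := hv
  have hsuf (c : α) : v ++ [c] <:+: s ++ v ++ [c] := ⟨s, [], by simp⟩
  exact ⟨a, b, hab, (hsuf a).trans ha, (hsuf b).trans hb⟩

theorem paramR_le_length (w : List α) : paramR w ≤ w.length :=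
  Nat.sInf_le fun _ hv h => h.length_lt.ne hv

theorem not_isRightSpecial_of_length_eq_paramR (hv : v.length = paramR w) :
    ¬ IsRightSpecial w v :=
  Nat.sInf_mem (s := {n | ∀ v : List α, v.length = n → ¬ IsRightSpecial w v})
    ⟨w.length, fun _ hv h => h.length_lt.ne hv⟩ v hv

theorem complexity_eq_zero {n : ℕ} (hn : w.length < n) : complexity w n = 0 := by
  rw [complexity, Set.ncard_eq_zero (finite_factors w n)]
  ext x
  simp only [Set.mem_ofPred_eq, Set.mem_empty_iff_false, iff_false, not_and]
  intro hx hl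
  have := hx.length_le
  omega

/-! ### Arithmetic of the trapezoidal shape -/

namespace IsTrapezoidal

/-- Complexity peaks at m + 1 and falls by one per step from M down to 0 at |w| + 1, so |w| = m + M.
-/
theorem length_eq (h : IsTrapezoidal w) (hK : paramK w ≤ w.length) :
    w.length = paramR w + paramK w := by
  obtain ⟨-, h1, h2, h3⟩ := h
  have hR := paramR_le_length w
  set m := min (paramR w) (paramK w) with hm
  set M := max (paramR w) (paramK w) with hM
  have hconst : ∀ j, m + j ≤ M → complexity w (m + j) = m + 1 := by
    intro j
    induction j with
    | zero => intro _; exact h1 m le_rfl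
    | succ j ih => intro hj; rw [← add_assoc, h2 (m + j) (by omega) (by omega), ih (by omega)]
  have hdec : ∀ j, M + j ≤ w.length + 1 → complexity w (M + j) + j = m + 1 := by
    intro j
    induction j with
    | zero =>
      intro _
      have := hconst (M - m) (by omega)
      rwa [Nat.add_sub_cancel' (by omega : m ≤ M)] at this
    | succ j ih =>
      intro hj
      have := h3 (M + j) (by omega) (by omega)
      have := ih (by omega)
      rw [add_assoc] at *
      omega
  have := hdec (w.length + 1 - M) (by omega)
  rw [Nat.add_sub_cancel' (by omega), complexity_eq_zero (by omega)] at this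
  omega

theorem complexity_succ_of_lt (h : IsTrapezoidal w) {n : ℕ}
    (hn : n < paramR w) :
    complexity w (n + 1) + (if paramK w ≤ n then 1 else 0) = complexity w n + 1 := by
  obtain ⟨-, h1, h2, h3⟩ := h
  split_ifs with hk
  · rw [h2 n (by omega) (by omega)]
  · rw [h1 n (by omega), h1 (n + 1) (by omega)]

theorem complexity_succ_paramR (h : IsTrapezoidal w) :
    complexity w (paramR w + 1) + (if paramK w ≤ paramR w then 1 else 0) =
      complexity w (paramR w) := by
  obtain ⟨-, h1, h2, h3⟩ := h
  split_ifs with hk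
  · exact h3 _ (by omega) (paramR_le_length w)
  · rw [h2 _ (by omega) (by omega), add_zero]

end IsTrapezoidal

/-! ### Special factors of closed trapezoidal words -/

theorem IsClosingBorder.existsUnique_isRightSpecial_of_lt_paramR (hv : IsClosingBorder w v)
    (h : IsTrapezoidal w) {n : ℕ} (hn : n < paramR w) :
    ∃! x : List α, IsRightSpecial w x ∧ x.length = n := by
  refine hv.existsUnique_isRightSpecial (hn.le.trans (paramR_le_length w)) ?_
  simpa only [hv.paramK_eq, Nat.succ_le_iff] using h.complexity_succ_of_lt hn

theorem IsClosingBorder.existsUnique_isLeftSpecial_of_lt_paramR (hv : IsClosingBorder w v)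
    (h : IsTrapezoidal w) {n : ℕ} (hn : n < paramR w) :
    ∃! x : List α, IsLeftSpecial w x ∧ x.length = n := by
  have hc := h.complexity_succ_of_lt hn
  rw [hv.paramK_eq] at hc
  obtain ⟨x, ⟨hx, hxl⟩, huniq⟩ := hv.reverse.existsUnique_isRightSpecial (n := n)
    (by simpa using hn.le.trans (paramR_le_length w))
    (by simpa only [complexity_reverse, List.length_reverse, Nat.succ_le_iff] using hc)
  refine ⟨x.reverse, ⟨isRightSpecial_reverse_iff.1 (by simpa using hx), by simpa using hxl⟩, ?_⟩
  rintro y ⟨hy, hyl⟩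
  rw [← huniq y.reverse ⟨isRightSpecial_reverse_iff.2 hy, by simpa using hyl⟩,
    List.reverse_reverse]

theorem IsClosingBorder.not_isLeftSpecial_of_length_eq_paramR (hv : IsClosingBorder w v)
    (h : IsTrapezoidal w) (hu : u.length = paramR w) : ¬ IsLeftSpecial w u := by
  rw [← isRightSpecial_reverse_iff]
  have hc := h.complexity_succ_paramR
  rw [hv.paramK_eq] at hc
  exact hv.reverse.not_isRightSpecial (n := paramR w) (by simpa using paramR_le_length w)
    (by simpa only [complexity_reverse, List.length_reverse, Nat.succ_le_iff] using hc)
    (by simpa using hu)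

theorem IsRightSpecial.length_lt_paramR (h : IsRightSpecial w u) : u.length < paramR w := by
  by_contra! hle
  refine not_isRightSpecial_of_length_eq_paramR (w := w) (v := u.drop (u.length - paramR w)) ?_
    (h.of_suffix (List.drop_suffix _ _))
  rw [List.length_drop]
  omega

theorem IsLeftSpecial.of_prefix (h : IsLeftSpecial w u) (hv : v <+: u) : IsLeftSpecial w v :=
  isRightSpecial_reverse_iff.1
    ((isRightSpecial_reverse_iff.2 h).of_suffix (List.reverse_suffix.2 hv))

theorem IsClosingBorder.length_lt_paramR (hv : IsClosingBorder w v) (h : IsTrapezoidal w)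
    (hu : IsLeftSpecial w u) : u.length < paramR w := by
  by_contra! hle
  refine hv.not_isLeftSpecial_of_length_eq_paramR h (u := u.take (paramR w)) ?_
    (hu.of_prefix (List.take_prefix _ _))
  rw [List.length_take]
  omega

theorem IsLongestRightSpecial.reverse (h : IsLongestRightSpecial w u) :
    IsLongestLeftSpecial w.reverse u.reverse := by
  refine ⟨isRightSpecial_reverse_iff.1 (by simpa using h.1), fun x hx => ?_⟩
  simpa using h.2 x.reverse (by simpa using isRightSpecial_reverse_iff.2 hx)

/-- If the longest left special factor is not right special, one of its two left extensions occurs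
only as a suffix of the word, which leaves only the closing border. -/
theorem IsClosingBorder.eq_of_isLongestLeftSpecial (hv : IsClosingBorder w v)
    (hu : IsLongestLeftSpecial w u) (hnot : ¬ IsRightSpecial w u) : u = v := by
  obtain ⟨⟨a, b, hab, ha, hb⟩, hmax⟩ := hu
  have htail {d c : α} (h : (d :: u) ++ [c] <:+: w) : u ++ [c] <:+: w :=
    List.IsInfix.trans ⟨[d], [], by simp⟩ h
  have hnotboth : ¬ ((∃ c, (a :: u) ++ [c] <:+: w) ∧ ∃ d, (b :: u) ++ [d] <:+: w) := by
    rintro ⟨⟨c, hc⟩, d, hd⟩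
    have hcd : c = d := by
      by_contra hne
      exact hnot ⟨c, d, hne, htail hc, htail hd⟩
    subst hcd
    have := hmax (u ++ [c]) ⟨a, b, hab, hc, hd⟩
    simp at this
  have hsuf {d : α} (hd : d :: u <:+: w) (hext : ¬ ∃ c, (d :: u) ++ [c] <:+: w) :
      d :: u <:+ w := by
    obtain ⟨s, t, hst⟩ := hd
    rcases t with _ | ⟨c, t⟩
    · exact ⟨s, by simpa using hst⟩
    · exact absurd ⟨c, s, t, by simpa using hst⟩ hext
  -- An unextendable `d :: u` is a suffix longer than `v`. Were |v| < |u|, the suffix `u` would be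
  -- unextendable too, making `e :: u` a suffix as well.
  have key {d e : α} (hde : d ≠ e) (hd : d :: u <:+: w) (he : e :: u <:+: w)
      (hext : ¬ ∃ c, (d :: u) ++ [c] <:+: w) : u = v := by
    have hds := hsuf hd hext
    have hus : u <:+ w := (List.suffix_cons d u).trans hds
    have hgt : v.length < (d :: u).length := by
      by_contra! hle
      exact hext (hv.exists_concat_infix hd hle)
    have hle : u.length ≤ v.length := by
      by_contra! hlt
      have hes : e :: u <:+ w := hsuf he fun ⟨c, hc⟩ =>
        hv.not_concat_infix hus hlt c (htail hc)
      have := (List.suffix_of_suffix_length_le hds hes (by simp)).eq_of_length (by simp)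
      exact hde (by simpa using this)
    rw [List.length_cons] at hgt
    exact (List.suffix_of_suffix_length_le hus hv.isSuffix hle).eq_of_length (by omega)
  by_cases hext : ∃ c, (a :: u) ++ [c] <:+: w
  · exact key hab.symm hb ha fun h => hnotboth ⟨hext, h⟩
  · exact key hab ha hb hext

theorem IsClosingBorder.eq_of_isLongestRightSpecial (hv : IsClosingBorder w v)
    (hu : IsLongestRightSpecial w u) (hnot : ¬ IsLeftSpecial w u) : u = v :=
  List.reverse_injective
    (hv.reverse.eq_of_isLongestLeftSpecial hu.reverse
      fun h => hnot (isRightSpecial_reverse_iff.1 h))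

/-! ### Periods and centrality -/

theorem hasPeriod_length_sub (hp : v <+: w) (hs : v <:+ w) :
    w.HasPeriod (w.length - v.length) := by
  obtain ⟨s, rfl⟩ := hs
  rw [List.HasPeriod]
  simpa using hp

theorem exists_getElem?_of_concat_infix {a : α} (h : u ++ [a] <:+: w) :
    ∃ i, i + u.length < w.length ∧ (∀ k < u.length, w[i + k]? = u[k]?) ∧
      w[i + u.length]? = some a := by
  obtain ⟨s, t, rfl⟩ := h
  refine ⟨s.length, by simp, fun k hk => ?_, by simp⟩
  simp [List.getElem?_append_right, List.getElem?_append_left, hk]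

theorem isCentral_of_two_occurrences {i p : ℕ} {a b : α} (hper : w.HasPeriod (u.length + 2))
    (hp0 : 0 < p) (hp : p < u.length + 2) (hab : a ≠ b) (hlen : i + p + u.length < w.length)
    (hi : ∀ k < u.length, w[i + k]? = u[k]?) (hj : ∀ k < u.length, w[i + p + k]? = u[k]?)
    (ha : w[i + u.length]? = some a) (hb : w[i + p + u.length]? = some b) : IsCentral u := by
  have hw := List.hasPeriod_iff_getElem?.1 hper
  obtain ⟨q, hq⟩ : ∃ q, u.length + 2 = p + q := ⟨u.length + 2 - p, by omega⟩
  have hup : u.HasPeriod p := List.hasPeriod_iff_getElem?.2 fun k hk => by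
    rw [← hj k (by omega), ← hi (k + p) (by omega)]
    congr 1
    omega
  have huq : u.HasPeriod q := List.hasPeriod_iff_getElem?.2 fun k hk => by
    rw [← hi k (by omega), ← hj (k + q) (by omega), hw (i + k) (by omega)]
    congr 1
    omega
  refine ⟨p, q, hp0, by omega, ?_, hup, huq, hq⟩
  by_contra hcop
  have hd1 : 2 ≤ p.gcd q := by
    have h0 := Nat.gcd_pos_of_pos_left q hp0
    rw [Nat.Coprime] at hcop
    omega
  have hp2 : p.gcd q ≤ p := Nat.gcd_le_left q hp0
  have hq2 : p.gcd q ≤ q := Nat.gcd_le_right p (by omega)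
  -- Fine and Wilf: |u| = p + q - 2 suffices because the gcd is at least 2.
  have hgcd := List.hasPeriod_iff_forall_getElem?_mod.1 (hup.gcd huq (by omega))
  -- The letter `a` after the first copy lies at index q - 2 of the second; `b` lies one period |u|
  -- + 2 after index p - 2 of the first.
  have hua : u[q - 2]? = some a := by
    rw [← ha, ← hj (q - 2) (by omega)]
    congr 1
    omega
  have hub : u[p - 2]? = some b := by
    rw [← hb, ← hi (p - 2) (by omega), hw (i + (p - 2)) (by omega)]
    congr 1
    omega
  have hmod : (q - 2) % p.gcd q = (p - 2) % p.gcd q := by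
    have h : (q - 2) ≡ (p - 2) [MOD p.gcd q] := by
      refine Nat.ModEq.add_right_cancel' 2 ?_
      rw [Nat.sub_add_cancel (by omega), Nat.sub_add_cancel (by omega)]
      exact ((Nat.modEq_zero_iff_dvd.2 (Nat.gcd_dvd_right p q)).trans
        (Nat.modEq_zero_iff_dvd.2 (Nat.gcd_dvd_left p q)).symm)
    exact h
  rw [hgcd _ (by omega), hmod, ← hgcd _ (by omega), hub] at hua
  exact hab (Option.some.inj hua).symm

/-- A right special factor of length `n` of a word with period `n + 2` is central. -/
theorem IsRightSpecial.isCentral (h : IsRightSpecial w u) (hper : w.HasPeriod (u.length + 2)) :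
    IsCentral u := by
  obtain ⟨a, b, hab, ha, hb⟩ := h
  obtain ⟨i, hil, hi, hia⟩ := exists_getElem?_of_concat_infix ha
  obtain ⟨j, hjl, hj, hjb⟩ := exists_getElem?_of_concat_infix hb
  clear ha hb
  wlog hij : i ≤ j generalizing a b i j
  · exact this b a hab.symm j hjl hj hjb i hil hi hia (by omega)
  -- The second occurrence, with its following letter, is moved left by whole periods; shift 0 would
  -- give a = b.
  have hdm := Nat.mod_add_div (j - i) (u.length + 2)
  set p := (j - i) % (u.length + 2) with hp
  set c := (j - i) / (u.length + 2)
  have hpj : i + p ≤ j := by omega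
  have hshift : ∀ k ≤ u.length, w[i + p + k]? = w[j + k]? := fun k hk => by
    rw [← hper.getElem?_mod _ (i + p + k) _ (by omega), ← hper.getElem?_mod _ (j + k) _ (by omega)]
    have : j + k = i + p + k + (u.length + 2) * c := by omega
    rw [this, Nat.add_mul_mod_self_left]
  rcases Nat.eq_zero_or_pos p with h0 | h0
  · have := hshift u.length le_rfl
    rw [h0, add_zero, hia, hjb] at this
    exact absurd (Option.some.inj this) hab
  · exact isCentral_of_two_occurrences hper h0 (Nat.mod_lt _ (by omega)) hab (by omega) hi
      (fun k hk => (hshift k hk.le).trans (hj k hk)) hia ((hshift _ le_rfl).trans hjb)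

end TrapWord

theorem lemma4p5 {α : Type*} (w u : List α)
    (htrap : TrapWord.IsTrapezoidal w) (hclosed : TrapWord.IsClosedWord w)
    (hu : TrapWord.IsLongestLeftSpecial w u) :
    TrapWord.IsLongestRightSpecial w u ∧
      (∀ v : List α, TrapWord.IsLongestRightSpecial w v → v = u) ∧
      TrapWord.IsBispecial w u ∧
      TrapWord.IsCentral u := by
  obtain ⟨v, hv⟩ := hclosed.exists_isClosingBorder htrap.1
  have hR := hv.length_lt_paramR htrap hu.1
  have hlt : TrapWord.paramR w - 1 < TrapWord.paramR w := by omega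
  obtain ⟨x, ⟨hx, hxl⟩, -⟩ := hv.existsUnique_isLeftSpecial_of_lt_paramR htrap hlt
  have hul : u.length = TrapWord.paramR w - 1 := by
    have := hu.2 x hx
    omega
  obtain ⟨y, ⟨hy, hyl⟩, hyu⟩ := hv.existsUnique_isRightSpecial_of_lt_paramR htrap hlt
  have hylong : TrapWord.IsLongestRightSpecial w y :=
    ⟨hy, fun z hz => by have := hz.length_lt_paramR; omega⟩
  have huy : u = y := by
    by_cases hyL : TrapWord.IsLeftSpecial w y
    · exact (hv.existsUnique_isLeftSpecial_of_lt_paramR htrap hlt).unique ⟨hu.1, hul⟩ ⟨hyL, hyl⟩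
    · by_cases huR : TrapWord.IsRightSpecial w u
      · exact hyu u ⟨huR, hul⟩
      · rw [hv.eq_of_isLongestLeftSpecial hu huR, hv.eq_of_isLongestRightSpecial hylong hyL]
  subst huy
  refine ⟨hylong, fun z hz => hyu z ⟨hz.1, ?_⟩, ⟨hu.1, hy⟩, hy.isCentral ?_⟩
  · have := hz.2 u hy
    have := hylong.2 z hz.1
    omega
  · have hper := TrapWord.hasPeriod_length_sub hv.isPrefix hv.isSuffix
    have hK := hv.paramK_eq
    have hvl := hv.length_lt
    have hN := htrap.length_eq (by omega)
    rwa [show w.length - v.length = u.length + 2 by omega] at hper
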